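/- **Theorem (existence of initial algebras).** Let $\kappa$ be a Mahlo cardinal, i.e. an inaccessible cardinal such that every closed unbounded subset of $\kappa$ contains a regular cardinal. Let $\mathsf{Set}$ be the universe of sets of cardinality less than $\kappa$; "small" means small with respect to this universe. Let $\mathbb{C}$ be a (possibly large) category that has all small connected colimits. Let $\mathrm{Fam}(\mathbb{C})$ be the category whose objects are pairs $(X,P)$ with $X$ in $\mathsf{Set}$ and $P:X\to\mathbb{C}$ a family of objects, and whose morphisms $(X,P)\to(Y,Q)$ are pairs $(h,k)$ of a function $h:X\to Y$ and a family of morphisms $k_x:P(x)\to Q(h(x))$ of $\mathbb{C}$. It has all small coproducts $\sum_{a\in A}(X_a,P_a)=(\sum_{a\in A}X_a,[P_a]_{a\in A})$, with injections $\mathsf{in}_a$ and cotupling $[-]$. The category $\mathrm{IR}^+(\mathbb{C})$ of positive inductive-recursive codes is defined by simultaneous induction on codes and morphisms. Codes are generated by * $\iota\,c$ for an object $c$ of $\mathbb{C}$; * $\sigma_A f$ for $A$ in $\mathsf{Set}$ and a function $f:A\to\mathrm{IR}^+(\mathbb{C})$; * $\delta_A F$ for $A$ in $\mathsf{Set}$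 and a functor $F:(A\to\mathbb{C})\to\mathrm{IR}^+(\mathbb{C})$, where $A\to\mathbb{C}$ is the category of $A$-indexed families of objects of $\mathbb{C}$ with componentwise morphisms. Morphisms exist only between codes of the same kind: * a morphism $\iota\,c\to\iota\,c'$ is a morphism $c\to c'$ of $\mathbb{C}$; * a morphism $\sigma_A f\to\sigma_B g$ is a pair of a function $\alpha:A\to B$ and a family of morphisms $\rho_x:f(x)\to g(\alpha(x))$, $x\in A$; * a morphism $\delta_A F\to\delta_B G$ is a pair of a function $\alpha:B\to A$ and a natural transformation $\rho:F\to G(-\circ\alpha)$. Identities and composition are the evident ones. Each code $\gamma$ induces an endofunctor $⟦\gamma⟧$ of $\mathrm{Fam}(\mathbb{C})$, and each morphism $\rho:\gamma\to\gamma'$ induces a natural transformation $⟦\rho⟧:⟦\gamma⟧\to⟦\gamma'⟧$, by recursion. On objects, $$⟦\iota\,c⟧(X,P)=(1,\ast\mapsto c),\qquad ⟦\sigma_A f⟧(X,P)=\sum_{a\in A}⟦f(a)⟧(X,P),\qquad ⟦\delta_A F⟧(X,P)=\sum_{g:A\to X}⟦F(P\circ g)⟧(X,P).$$ On a morphism $(h,k):(X,P)\to(Y,Q)$,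 $⟦\iota\,c⟧(h,k)$ is the identity, $$⟦\sigma_A f⟧(h,k)=[\mathsf{in}_a\circ⟦f(a)⟧(h,k)]_{a\in A},$$ $$⟦\delta_A F⟧(h,k)=[\mathsf{in}_{h\circ g}\circ⟦F(Q\circ h\circ g)⟧(h,k)\circ⟦F(g^*k)⟧_{(X,P)}]_{g:A\to X},\qquad (g^*k)_a=k_{g(a)}.$$ On morphisms of codes, the component at $(X,P)$ of the transformation induced by $f:c\to c'$, by $(\alpha,\rho):\sigma_A f\to\sigma_B g$, and by $(\alpha,\rho):\delta_A F\to\delta_B G$ is respectively $$(\mathrm{id}_1,f),\qquad [\mathsf{in}_{\alpha(x)}\circ⟦\rho_x⟧_{(X,P)}]_{x\in A},\qquad [\mathsf{in}_{g\circ\alpha}\circ⟦\rho_{P\circ g}⟧_{(X,P)}]_{g:A\to X}.$$ Then for every code $\gamma$ in $\mathrm{IR}^+(\mathbb{C})$ the functor $⟦\gamma⟧:\mathrm{Fam}(\mathbb{C})\to\mathrm{Fam}(\mathbb{C})$ has an initial algebra. -/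

import Mathlib

open CategoryTheory

universe u v w

namespace PosIR

/-! ### Mahlo cardinals -/

/-- `S` is a closed unbounded subset of the ordinal `o`. -/
structure IsClub (S : Set Ordinal.{u}) (o : Ordinal.{u}) : Prop where
  subset : ∀ a ∈ S, a < o
  closed : ∀ p < o, 0 < p → (∀ a < p, ∃ b ∈ S, a < b ∧ b < p) → p ∈ S
  unbounded : ∀ a < o, ∃ b ∈ S, a < b

/-- A cardinal `κ` is Mahlo if it is (strongly) inaccessible and the set of regular cardinals
below `κ` is stationary in `κ`, i.e. meets every closed unbounded subset of `κ`. -/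
structure IsMahlo (κ : Cardinal.{u}) : Prop where
  isInaccessible : κ.IsInaccessible
  stationary : ∀ S : Set Ordinal.{u}, IsClub S κ.ord → ∃ μ : Cardinal.{u}, μ.IsRegular ∧ μ.ord ∈ S

/-! ### The universe `Set` of sets determined by an inaccessible cardinal -/

/-- The universe of small sets attached to `κ`: the types of cardinality less than `κ`. -/
structure SmallSet (κ : Cardinal.{u}) : Type (u + 1) where
  carrier : Type u
  card_lt : Cardinal.mk carrier < κ

instance (κ : Cardinal.{u}) : CoeSort (SmallSet κ) (Type u) := ⟨SmallSet.carrier⟩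

namespace SmallSet

variable {κ : Cardinal.{u}}

/-- The one-element set. -/
def one (hκ : κ.IsInaccessible) : SmallSet κ :=
  ⟨PUnit, by simpa using hκ.nat_lt 1⟩

/-- Dependent sums of small sets are small. -/
def sigma (hκ : κ.IsInaccessible) (A : SmallSet κ) (B : A → SmallSet κ) : SmallSet κ :=
  ⟨Σ a : A, B a, by
    rw [Cardinal.mk_sigma]
    exact Cardinal.sum_lt_of_isRegular hκ.isRegular A.card_lt fun a => (B a).card_lt⟩

theorem card_fun_lt (hκ : κ.IsInaccessible) (A B : SmallSet κ) :
    Cardinal.mk (A → B) < κ := by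
  have h : Cardinal.mk (A → B) ≤ 2 ^ Cardinal.mk (A × B) := by
    rw [← Cardinal.mk_set]
    refine Cardinal.mk_le_of_injective (f := fun g => {p : A × B | g p.1 = p.2}) ?_
    intro g g' hgg
    funext a
    have : (a, g a) ∈ {p : A × B | g' p.1 = p.2} := by
      rw [← show {p : A × B | g p.1 = p.2} = {p : A × B | g' p.1 = p.2} from hgg]
      rfl
    exact this.symm
  refine h.trans_lt (hκ.isStrongLimit.isStrongPrelimit ?_)
  rw [Cardinal.mk_prod, Cardinal.lift_id, Cardinal.lift_id]
  exact Cardinal.mul_lt_of_lt hκ.isRegular.aleph0_le A.card_lt B.card_lt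

/-- Function sets of small sets are small. -/
def pi (hκ : κ.IsInaccessible) (A B : SmallSet κ) : SmallSet κ :=
  ⟨A → B, card_fun_lt hκ A B⟩

end SmallSet

/-! ### The category of families -/

/-- Objects of `Fam(C)`: a small set together with a family of objects of `C` indexed by it. -/
structure Fam (κ : Cardinal.{u}) (C : Type v) : Type (max (u + 1) v) where
  idx : SmallSet κ
  obj : idx → C

namespace Fam

variable {κ : Cardinal.{u}} {C : Type v} [Category.{w} C]

/-- Morphisms `(h, k) : (X, P) ⟶ (Y, Q)` of families: a function `h : X → Y` and a family of
morphisms `k x : P x ⟶ Q (h x)`. -/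
structure Hom (X Y : Fam κ C) : Type (max u w) where
  fn : X.idx → Y.idx
  app : ∀ x, X.obj x ⟶ Y.obj (fn x)

instance : Category (Fam κ C) where
  Hom := Hom
  id X := ⟨fun x => x, fun x => 𝟙 (X.obj x)⟩
  comp φ ψ := ⟨fun x => ψ.fn (φ.fn x), fun x => φ.app x ≫ ψ.app (φ.fn x)⟩
  id_comp := by
    rintro X Y ⟨h, k⟩
    congr 1
    funext x
    exact Category.id_comp _
  comp_id := by
    rintro X Y ⟨h, k⟩
    congr 1
    funext x
    exact Category.comp_id _
  assoc := by
    rintro W X Y Z ⟨h, k⟩ ⟨h', k'⟩ ⟨h'', k''⟩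
    congr 1
    funext x
    exact Category.assoc _ _ _

theorem hom_congr {X Y : Fam κ C} (h : X.idx → Y.idx) {k k' : ∀ x, X.obj x ⟶ Y.obj (h x)}
    (e : ∀ x, k x = k' x) : (Hom.mk h k : X ⟶ Y) = Hom.mk h k' :=
  congrArg (Hom.mk h) (funext e)

/-- The coproduct `∑ a : A, (X a, P a) = (Σ a : A, X a, [P a])` of a small set of families. -/
def coprod (hκ : κ.IsInaccessible) (A : SmallSet κ) (Y : A → Fam κ C) : Fam κ C where
  idx := SmallSet.sigma hκ A fun a => (Y a).idx
  obj := fun p : (Σ a : A, (Y a).idx) => (Y p.1).obj p.2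

/-- The coproduct injections. -/
def inj (hκ : κ.IsInaccessible) {A : SmallSet κ} (Y : A → Fam κ C) (a : A) :
    Y a ⟶ coprod hκ A Y where
  fn x := (⟨a, x⟩ : Σ a : A, (Y a).idx)
  app x := 𝟙 ((Y a).obj x)

/-- Cotupling of morphisms out of a coproduct. -/
def desc (hκ : κ.IsInaccessible) {A : SmallSet κ} {Y : A → Fam κ C} {Z : Fam κ C}
    (φ : ∀ a, Y a ⟶ Z) : coprod hκ A Y ⟶ Z where
  fn := fun p : (Σ a : A, (Y a).idx) => (φ p.1).fn p.2
  app := fun p : (Σ a : A, (Y a).idx) => (φ p.1).app p.2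

@[simp]
theorem inj_desc (hκ : κ.IsInaccessible) {A : SmallSet κ} {Y : A → Fam κ C} {Z : Fam κ C}
    (φ : ∀ a, Y a ⟶ Z) (a : A) : inj hκ Y a ≫ desc hκ φ = φ a := by
  change Hom.mk (φ a).fn (fun x => 𝟙 ((Y a).obj x) ≫ (φ a).app x) = Hom.mk (φ a).fn (φ a).app
  congr 1
  funext x
  exact Category.id_comp _

@[simp]
theorem inj_desc_assoc (hκ : κ.IsInaccessible) {A : SmallSet κ} {Y : A → Fam κ C} {Z W : Fam κ C}
    (φ : ∀ a, Y a ⟶ Z) (a : A) (ψ : Z ⟶ W) : inj hκ Y a ≫ desc hκ φ ≫ ψ = φ a ≫ ψ := by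
  rw [← Category.assoc, inj_desc]

theorem desc_ext (hκ : κ.IsInaccessible) {A : SmallSet κ} {Y : A → Fam κ C} {Z : Fam κ C}
    {φ ψ : coprod hκ A Y ⟶ Z} (h : ∀ a, inj hκ Y a ≫ φ = inj hκ Y a ≫ ψ) : φ = ψ := by
  have key : ∀ χ : coprod hκ A Y ⟶ Z, χ = desc hκ fun a => inj hκ Y a ≫ χ := by
    rintro ⟨f, k⟩
    change _ = Hom.mk _ _
    congr 1
    funext p
    exact (Category.id_comp _).symm
  rw [key φ, key ψ]
  congr 1
  funext a
  exact h a

end Fam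

/-! ### Codes and their morphisms

The type of codes and the type of morphisms between codes are defined by a simultaneous
(inductive-inductive) definition: in a code `δ_A F`, the argument `F : (A → C) ⥤ IR⁺(C)` is a
functor into the category being defined.  Such a definition is not available as a primitive, and is
unfolded as follows.

* `Skel` are the codes with the functors `F` replaced by their action on objects;
* `RawHom` are the morphisms of codes, with the naturality conditions left out (naturality is a
  condition on, not additional data of, a morphism);
* `PreCode s` adds to a skeleton `s`, at each `δ`, an action of `F` on morphisms;
* `RawHom.IsNat` is the hereditary naturality condition on morphisms, and `PreCode.WF` says
  that, hereditarily, the action of each `F` on morphisms has values in natural morphisms of codes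
  and preserves identities and composition.

A code is then a skeleton with a well-formed `PreCode` over it, and a morphism of codes is a
natural raw morphism.  The introduction rules, the morphism rules and the induction principle of
the simultaneous definition are derived below. -/

variable (κ : Cardinal.{u}) (C : Type v) [Category.{w} C]

/-- Object parts of codes. -/
inductive Skel (κ : Cardinal.{u}) (C : Type v) : Type (max (u + 1) v)
  | iota (c : C) : Skel κ C
  | sigma (A : SmallSet κ) (f : A → Skel κ C) : Skel κ C
  | delta (A : SmallSet κ) (F : (A → C) → Skel κ C) : Skel κ C

/-- Morphisms of codes, before imposing naturality. -/
inductive RawHom {κ : Cardinal.{u}} {C : Type v} [Category.{w} C] :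
    Skel κ C → Skel κ C → Type (max (u + 1) v w)
  | iota {c c' : C} (f : c ⟶ c') : RawHom (.iota c) (.iota c')
  | sigma {A B : SmallSet κ} {f : A → Skel κ C} {g : B → Skel κ C} (α : A → B)
      (ρ : ∀ x : A, RawHom (f x) (g (α x))) : RawHom (.sigma A f) (.sigma B g)
  | delta {A B : SmallSet κ} {F : (A → C) → Skel κ C} {G : (B → C) → Skel κ C} (α : B → A)
      (ρ : ∀ X : A → C, RawHom (F X) (G fun b => X (α b))) : RawHom (.delta A F) (.delta B G)

namespace RawHom

variable {κ : Cardinal.{u}} {C : Type v} [Category.{w} C]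

/-- Identities. -/
protected def id : (s : Skel κ C) → RawHom s s
  | .iota c => .iota (𝟙 c)
  | .sigma _ f => .sigma (fun a => a) fun a => RawHom.id (f a)
  | .delta _ F => .delta (fun a => a) fun X => RawHom.id (F X)

/-- Composition, in diagrammatic order. -/
protected def comp : {r s t : Skel κ C} → RawHom r s → RawHom s t → RawHom r t
  | _, _, _, .iota f, .iota g => .iota (f ≫ g)
  | _, _, _, .sigma β τ, .sigma α ρ => .sigma (fun x => α (β x)) fun x => (τ x).comp (ρ (β x))
  | _, _, _, .delta β τ, .delta α ρ =>
      .delta (fun b => β (α b)) fun X => (τ X).comp (ρ fun b => X (β b))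

protected theorem id_comp {s t : Skel κ C} (ρ : RawHom s t) : (RawHom.id s).comp ρ = ρ := by
  induction ρ with
  | iota f => simp [RawHom.id, RawHom.comp]
  | sigma α ρ ih => simp [RawHom.id, RawHom.comp, ih]
  | delta α ρ ih => simp [RawHom.id, RawHom.comp, ih]

protected theorem comp_id {s t : Skel κ C} (ρ : RawHom s t) : ρ.comp (RawHom.id t) = ρ := by
  induction ρ with
  | iota f => simp [RawHom.id, RawHom.comp]
  | sigma α ρ ih => simp [RawHom.id, RawHom.comp, ih]
  | delta α ρ ih => simp [RawHom.id, RawHom.comp, ih]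

protected theorem assoc {q r s t : Skel κ C} (ρ : RawHom q r) (τ : RawHom r s) (υ : RawHom s t) :
    (ρ.comp τ).comp υ = ρ.comp (τ.comp υ) := by
  induction ρ generalizing s t with
  | iota f => cases τ; cases υ; simp [RawHom.comp]
  | sigma α ρ ih => cases τ; cases υ; simp [RawHom.comp, ih]
  | delta α ρ ih => cases τ; cases υ; simp [RawHom.comp, ih]

end RawHom

/-- Skeletons together with, at each `δ`, an action on morphisms. -/
inductive PreCode {κ : Cardinal.{u}} {C : Type v} [Category.{w} C] :
    Skel κ C → Type (max (u + 1) v w)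
  | iota (c : C) : PreCode (.iota c)
  | sigma {A : SmallSet κ} {f : A → Skel κ C} (d : ∀ a, PreCode (f a)) : PreCode (.sigma A f)
  | delta {A : SmallSet κ} {F : (A → C) → Skel κ C} (d : ∀ X, PreCode (F X))
      (map : ∀ X Y : A → C, (X ⟶ Y) → RawHom (F X) (F Y)) : PreCode (.delta A F)

/-- Naturality of a morphism between codes: at each `δ`, the components `ρ X` form a natural
transformation `F ⟶ G (- ∘ α)` whose components are themselves natural. -/
def RawHom.IsNat {κ : Cardinal.{u}} {C : Type v} [Category.{w} C] :
    {s t : Skel κ C} → RawHom s t → PreCode s → PreCode t → Prop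
  | _, _, .iota _, _, _ => True
  | _, _, .sigma α ρ, .sigma d, .sigma e => ∀ x, (ρ x).IsNat (d x) (e (α x))
  | _, _, .delta α ρ, .delta d m, .delta e n =>
      (∀ X, (ρ X).IsNat (d X) (e fun b => X (α b))) ∧
        ∀ X Y (k : X ⟶ Y), (m X Y k).comp (ρ Y) = (ρ X).comp (n _ _ fun b => k (α b))

/-- Well-formedness: at each `δ`, the given data form a functor into codes. -/
def PreCode.WF {κ : Cardinal.{u}} {C : Type v} [Category.{w} C] :
    {s : Skel κ C} → PreCode s → Prop
  | _, .iota _ => True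
  | _, .sigma d => ∀ a, (d a).WF
  | _, .delta d m =>
      (∀ X, (d X).WF) ∧ (∀ X Y (k : X ⟶ Y), (m X Y k).IsNat (d X) (d Y)) ∧
        (∀ X, m X X (𝟙 X) = RawHom.id _) ∧
          ∀ X Y Z (k : X ⟶ Y) (l : Y ⟶ Z), m X Z (k ≫ l) = (m X Y k).comp (m Y Z l)

namespace RawHom

variable {κ : Cardinal.{u}} {C : Type v} [Category.{w} C]

theorem isNat_id {s : Skel κ C} (d : PreCode s) : (RawHom.id s).IsNat d d := by
  induction d with
  | iota c => simp [RawHom.id, IsNat]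
  | sigma d ih => simpa [RawHom.id, IsNat] using ih
  | delta d m ih => exact ⟨ih, fun X Y k => by rw [RawHom.comp_id, RawHom.id_comp]⟩

theorem IsNat.comp {r s t : Skel κ C} {ρ : RawHom r s} {τ : RawHom s t} {d : PreCode r}
    {e : PreCode s} {f : PreCode t} (hρ : ρ.IsNat d e) (hτ : τ.IsNat e f) :
    (ρ.comp τ).IsNat d f := by
  induction ρ generalizing t with
  | iota g => cases τ; simp [RawHom.comp, IsNat]
  | sigma α ρ ih =>
    cases τ; cases d; cases e; cases f
    exact fun x => ih x (hρ x) (hτ (α x))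
  | delta α ρ ih =>
    cases τ; cases d; cases e; cases f
    refine ⟨fun X => ih X (hρ.1 X) (hτ.1 _), fun X Y k => ?_⟩
    rw [← RawHom.assoc, hρ.2, RawHom.assoc, hτ.2, ← RawHom.assoc]

end RawHom

end PosIR

open PosIR

/-- The codes `γ : IR⁺(C)` for positive inductive-recursive definitions. -/
structure IRPlus (κ : Cardinal.{u}) (C : Type v) [Category.{w} C] : Type (max (u + 1) v w) where
  skel : Skel κ C
  pre : PreCode skel
  wf : pre.WF

namespace IRPlus

variable {κ : Cardinal.{u}} {C : Type v} [Category.{w} C]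

/-- Morphisms of codes. -/
@[ext]
structure Hom (γ γ' : IRPlus κ C) : Type (max (u + 1) v w) where
  raw : RawHom γ.skel γ'.skel
  isNat : raw.IsNat γ.pre γ'.pre

/-- The category `IR⁺(C)`. -/
instance : Category.{max (u + 1) v w} (IRPlus κ C) where
  Hom := Hom
  id γ := ⟨RawHom.id γ.skel, RawHom.isNat_id γ.pre⟩
  comp ρ τ := ⟨ρ.raw.comp τ.raw, ρ.isNat.comp τ.isNat⟩
  id_comp ρ := Hom.ext (RawHom.id_comp ρ.raw)
  comp_id ρ := Hom.ext (RawHom.comp_id ρ.raw)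
  assoc ρ τ υ := Hom.ext (RawHom.assoc ρ.raw τ.raw υ.raw)

/-! #### Introduction rules and induction principle -/

/-- The code `ι c`. -/
def iota (c : C) : IRPlus κ C := ⟨.iota c, .iota c, trivial⟩

/-- The code `σ_A f`. -/
def sigma (A : SmallSet κ) (f : A → IRPlus κ C) : IRPlus κ C :=
  ⟨.sigma A fun a => (f a).skel, .sigma fun a => (f a).pre, fun a => (f a).wf⟩

/-- The code `δ_A F`, for a functor `F : (A → C) ⥤ IR⁺(C)`. -/
def delta (A : SmallSet κ) (F : (A → C) ⥤ IRPlus κ C) : IRPlus κ C :=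
  ⟨.delta A fun X => (F.obj X).skel,
    .delta (fun X => (F.obj X).pre) fun _ _ k => (F.map k).raw,
    fun X => (F.obj X).wf, fun _ _ k => (F.map k).isNat,
    fun X => congrArg Hom.raw (F.map_id X), fun _ _ _ k l => congrArg Hom.raw (F.map_comp k l)⟩

/-- Morphisms `ι c ⟶ ι c'` are morphisms `c ⟶ c'`. -/
def homIota (c c' : C) : (c ⟶ c') ≃ ((iota c : IRPlus κ C) ⟶ iota c') where
  toFun f := ⟨.iota f, trivial⟩
  invFun ρ := match ρ with
    | ⟨.iota f, _⟩ => f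
  left_inv _ := rfl
  right_inv := by rintro ⟨⟨f⟩, _⟩; rfl

/-- Morphisms `σ_A f ⟶ σ_B g` are pairs of a function `α : A → B` and a family of morphisms
`f x ⟶ g (α x)`. -/
def homSigma {A B : SmallSet κ} (f : A → IRPlus κ C) (g : B → IRPlus κ C) :
    (Σ α : A → B, ∀ x, f x ⟶ g (α x)) ≃ (sigma A f ⟶ sigma B g) where
  toFun p := ⟨.sigma p.1 fun x => (p.2 x).raw, fun x => (p.2 x).isNat⟩
  invFun ρ := match ρ with
    | ⟨.sigma α ρ, h⟩ => ⟨α, fun x => ⟨ρ x, h x⟩⟩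
  left_inv _ := rfl
  right_inv := by rintro ⟨⟨⟩ | ⟨α, ρ⟩, _⟩; rfl

/-- Precomposition with `α : B → A`, as a functor `(A → C) ⥤ (B → C)`. -/
def precomp (C : Type v) [Category.{w} C] {A B : SmallSet κ} (α : B → A) : (A → C) ⥤ (B → C) where
  obj X b := X (α b)
  map k b := k (α b)

/-- Morphisms `δ_A F ⟶ δ_B G` are pairs of a function `α : B → A` and a natural transformation
from `F` to `G (- ∘ α)`. -/
def homDelta {A B : SmallSet κ} (F : (A → C) ⥤ IRPlus κ C) (G : (B → C) ⥤ IRPlus κ C) :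
    (Σ α : B → A, F ⟶ precomp C α ⋙ G) ≃ (delta A F ⟶ delta B G) where
  toFun p := ⟨.delta p.1 fun X => (p.2.app X).raw, fun X => (p.2.app X).isNat,
    fun _ _ k => congrArg Hom.raw (p.2.naturality k)⟩
  invFun ρ := match ρ with
    | ⟨.delta α ρ, h⟩ =>
      ⟨α, { app := fun X => ⟨ρ X, h.1 X⟩, naturality := fun X Y k => Hom.ext (h.2 X Y k) }⟩
  left_inv _ := rfl
  right_inv := by rintro ⟨⟨⟩ | ⟨⟩ | ⟨α, ρ⟩, _⟩; rfl

/-- Codes are generated by the three introduction rules. -/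
theorem induction {motive : IRPlus κ C → Prop} (iota : ∀ c, motive (iota c))
    (sigma : ∀ A f, (∀ a, motive (f a)) → motive (sigma A f))
    (delta : ∀ A F, (∀ X, motive (F.obj X)) → motive (delta A F)) (γ : IRPlus κ C) :
    motive γ := by
  obtain ⟨s, d, hd⟩ := γ
  induction d with
  | iota c => exact iota c
  | sigma d ih => exact sigma _ (fun a => ⟨_, d a, hd a⟩) fun a => ih a (hd a)
  | delta d m ih =>
    exact delta _
      { obj := fun X => ⟨_, d X, hd.1 X⟩
        map := fun {X Y} k => ⟨m X Y k, hd.2.1 X Y k⟩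
        map_id := fun X => Hom.ext (hd.2.2.1 X)
        map_comp := fun {X Y Z} k l => Hom.ext (hd.2.2.2 X Y Z k l) }
      fun X => ih X (hd.1 X)

end IRPlus

/-! ### Semantics -/

namespace PosIR

variable {κ : Cardinal.{u}} {C : Type v} [Category.{w} C] (hκ : κ.IsInaccessible)

/-- The action of a code on families. -/
def Skel.interp {κ : Cardinal.{u}} {C : Type v} [Category.{w} C] (hκ : κ.IsInaccessible) :
    Skel κ C → Fam κ C → Fam κ C
  | .iota c, _ => ⟨SmallSet.one hκ, fun _ => c⟩
  | .sigma A f, X => Fam.coprod hκ A fun a => (f a).interp hκ X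
  | .delta A F, X =>
      Fam.coprod hκ (SmallSet.pi hκ A X.idx)
        fun g : A → X.idx => (F fun a => X.obj (g a)).interp hκ X

/-- The components of the transformation induced by a morphism of codes. -/
def RawHom.interp {κ : Cardinal.{u}} {C : Type v} [Category.{w} C] (hκ : κ.IsInaccessible) :
    {s t : Skel κ C} → RawHom s t → (X : Fam κ C) → (s.interp hκ X ⟶ t.interp hκ X)
  | _, _, .iota f, _ => ⟨fun x => x, fun _ => f⟩
  | _, _, .sigma (g := g) α ρ, X =>
      Fam.desc hκ fun x => (ρ x).interp hκ X ≫ Fam.inj hκ (fun b => (g b).interp hκ X) (α x)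
  | _, _, .delta (A := A) (B := B) (G := G) α ρ, X =>
      Fam.desc (A := SmallSet.pi hκ A X.idx) hκ fun g : A → X.idx =>
        (ρ fun a => X.obj (g a)).interp hκ X ≫
          Fam.inj (A := SmallSet.pi hκ B X.idx) hκ
            (fun g' : B → X.idx => (G fun b => X.obj (g' b)).interp hκ X) fun b => g (α b)

/-- The action of a code on morphisms of families. -/
def PreCode.interp {κ : Cardinal.{u}} {C : Type v} [Category.{w} C] (hκ : κ.IsInaccessible) :
    {s : Skel κ C} → PreCode s → {X Y : Fam κ C} → (X ⟶ Y) → (s.interp hκ X ⟶ s.interp hκ Y)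
  | _, .iota _, _, _, _ => ⟨fun x => x, fun _ => 𝟙 _⟩
  | _, .sigma (f := f) d, _, Y, φ =>
      Fam.desc hκ fun a => (d a).interp hκ φ ≫ Fam.inj hκ (fun a => (f a).interp hκ Y) a
  | _, .delta (A := A) (F := F) d m, X, Y, φ =>
      Fam.desc (A := SmallSet.pi hκ A X.idx) hκ fun g : A → X.idx =>
        (m _ _ fun a => φ.app (g a)).interp hκ X ≫
          (d fun a => Y.obj (φ.fn (g a))).interp hκ φ ≫
            Fam.inj (A := SmallSet.pi hκ A Y.idx) hκ
              (fun g' : A → Y.idx => (F fun a => Y.obj (g' a)).interp hκ Y) fun a => φ.fn (g a)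

theorem RawHom.interp_id (s : Skel κ C) (X : Fam κ C) :
    (RawHom.id s).interp hκ X = 𝟙 (s.interp hκ X) := by
  induction s with
  | iota c => rfl
  | sigma A f ih =>
    refine Fam.desc_ext hκ fun a => (Fam.inj_desc hκ _ a).trans ?_
    refine (congrArg (· ≫ _) (ih a)).trans ((Category.id_comp _).trans (Category.comp_id _).symm)
  | delta A F ih =>
    refine Fam.desc_ext hκ fun g => (Fam.inj_desc hκ _ g).trans ?_
    exact (congrArg (· ≫ _) (ih _)).trans ((Category.id_comp _).trans (Category.comp_id _).symm)

theorem RawHom.interp_comp {r s t : Skel κ C} (ρ : RawHom r s) (τ : RawHom s t) (X : Fam κ C) :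
    (ρ.comp τ).interp hκ X = ρ.interp hκ X ≫ τ.interp hκ X := by
  induction ρ generalizing t with
  | iota f => cases τ; rfl
  | sigma α ρ ih =>
    cases τ with | sigma β τ => ?_
    refine Fam.desc_ext hκ fun a => (Fam.inj_desc hκ _ a).trans ?_
    refine (congrArg (· ≫ _) (ih a (τ (α a)))).trans ((Category.assoc _ _ _).trans ?_)
    refine Eq.symm ((Fam.inj_desc_assoc hκ _ a _).trans ((Category.assoc _ _ _).trans ?_))
    exact congrArg (_ ≫ ·) (Fam.inj_desc hκ _ (α a))
  | delta α ρ ih =>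
    cases τ with | delta β τ => ?_
    refine Fam.desc_ext hκ fun g => (Fam.inj_desc hκ _ g).trans ?_
    refine (congrArg (· ≫ _) (ih _ (τ _))).trans ((Category.assoc _ _ _).trans ?_)
    refine Eq.symm ((Fam.inj_desc_assoc hκ _ g _).trans ((Category.assoc _ _ _).trans ?_))
    exact congrArg (_ ≫ ·) (Fam.inj_desc hκ _ _)

theorem RawHom.interp_naturality {s t : Skel κ C} {ρ : RawHom s t} {d : PreCode s} {e : PreCode t}
    (h : ρ.IsNat d e) {X Y : Fam κ C} (φ : X ⟶ Y) :
    d.interp hκ φ ≫ ρ.interp hκ Y = ρ.interp hκ X ≫ e.interp hκ φ := by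
  induction ρ with
  | iota f =>
    cases d; cases e
    exact Fam.hom_congr _ fun _ => (Category.id_comp _).trans (Category.comp_id _).symm
  | sigma α ρ ih =>
    cases d with | sigma d => ?_
    cases e with | sigma e => ?_
    refine Fam.desc_ext hκ fun a => ?_
    refine (Fam.inj_desc_assoc hκ _ a _).trans ((Category.assoc _ _ _).trans ?_)
    refine (congrArg (_ ≫ ·) (Fam.inj_desc hκ _ a)).trans ((Category.assoc _ _ _).symm.trans ?_)
    refine (congrArg (· ≫ _) (ih a (h a))).trans ((Category.assoc _ _ _).trans ?_)
    refine Eq.symm ((Fam.inj_desc_assoc hκ _ a _).trans ((Category.assoc _ _ _).trans ?_))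
    exact congrArg (_ ≫ ·) (Fam.inj_desc hκ _ (α a))
  | delta α ρ ih =>
    cases d with | delta d m => ?_
    cases e with | delta e n => ?_
    refine Fam.desc_ext hκ fun g => ?_
    refine (Fam.inj_desc_assoc hκ _ g _).trans ((Category.assoc _ _ _).trans ?_)
    refine (congrArg (_ ≫ ·) ((Category.assoc _ _ _).trans
      (congrArg (_ ≫ ·) (Fam.inj_desc hκ _ _)))).trans ?_
    refine (congrArg (_ ≫ ·) ((Category.assoc _ _ _).symm.trans
      (congrArg (· ≫ _) (ih _ (h.1 _))))).trans ?_
    refine (congrArg (_ ≫ ·) (Category.assoc _ _ _)).trans ((Category.assoc _ _ _).symm.trans ?_)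
    refine (congrArg (· ≫ _) ((RawHom.interp_comp hκ _ _ X).symm.trans
      ((congrArg (fun r => RawHom.interp hκ r X) (h.2 _ _ fun a => φ.app (g a))).trans
        (RawHom.interp_comp hκ _ _ X)))).trans ?_
    refine (Category.assoc _ _ _).trans ?_
    refine Eq.symm ((Fam.inj_desc_assoc hκ _ g _).trans ((Category.assoc _ _ _).trans ?_))
    exact congrArg (_ ≫ ·) (Fam.inj_desc hκ _ _)

theorem PreCode.interp_id {s : Skel κ C} {d : PreCode s} (h : d.WF) (X : Fam κ C) :
    d.interp hκ (𝟙 X) = 𝟙 (s.interp hκ X) := by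
  induction d with
  | iota c => rfl
  | sigma d ih =>
    refine Fam.desc_ext hκ fun a => (Fam.inj_desc hκ _ a).trans ?_
    exact (congrArg (· ≫ _) (ih a (h a))).trans
      ((Category.id_comp _).trans (Category.comp_id _).symm)
  | delta d m ih =>
    refine Fam.desc_ext hκ fun g => (Fam.inj_desc hκ _ g).trans ?_
    refine (congrArg (· ≫ _) ((congrArg (fun r => RawHom.interp hκ r X) (h.2.2.1 _)).trans
      (RawHom.interp_id hκ _ X))).trans ((Category.id_comp _).trans ?_)
    exact (congrArg (· ≫ _) (ih _ (h.1 _))).trans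
      ((Category.id_comp _).trans (Category.comp_id _).symm)

theorem PreCode.interp_comp {s : Skel κ C} {d : PreCode s} (h : d.WF) {X Y Z : Fam κ C}
    (φ : X ⟶ Y) (ψ : Y ⟶ Z) :
    d.interp hκ (φ ≫ ψ) = d.interp hκ φ ≫ d.interp hκ ψ := by
  induction d with
  | iota c =>
    exact Fam.hom_congr _ fun _ => (Category.id_comp _).symm
  | sigma d ih =>
    refine Fam.desc_ext hκ fun a => (Fam.inj_desc hκ _ a).trans ?_
    refine (congrArg (· ≫ _) (ih a (h a))).trans ((Category.assoc _ _ _).trans ?_)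
    refine Eq.symm ((Fam.inj_desc_assoc hκ _ a _).trans ((Category.assoc _ _ _).trans ?_))
    exact congrArg (_ ≫ ·) (Fam.inj_desc hκ _ a)
  | delta d m ih =>
    refine Fam.desc_ext hκ fun g => (Fam.inj_desc hκ _ g).trans ?_
    refine (congrArg (· ≫ _) ((congrArg (fun r => RawHom.interp hκ r X)
      (h.2.2.2 _ _ _ (fun a => φ.app (g a)) fun a => ψ.app (φ.fn (g a)))).trans
      (RawHom.interp_comp hκ _ _ X))).trans ((Category.assoc _ _ _).trans ?_)
    refine Eq.symm ((Fam.inj_desc_assoc hκ _ g _).trans ((Category.assoc _ _ _).trans ?_))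
    refine congrArg (_ ≫ ·) ?_
    refine (Category.assoc _ _ _).trans ?_
    refine (congrArg (_ ≫ ·) (Fam.inj_desc hκ _ _)).trans ?_
    refine (Category.assoc _ _ _).symm.trans ?_
    refine (congrArg (· ≫ _)
      (RawHom.interp_naturality hκ (h.2.1 _ _ fun a => ψ.app (φ.fn (g a))) φ)).trans ?_
    refine (Category.assoc _ _ _).trans (congrArg (_ ≫ ·) ?_)
    refine (Category.assoc _ _ _).symm.trans ?_
    exact (congrArg (· ≫ _) (ih _ (h.1 _))).symm

end PosIR

/-- The endofunctor `⟦γ⟧ : Fam(C) ⥤ Fam(C)` induced by a code `γ : IR⁺(C)`. -/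
def IRPlus.interp {κ : Cardinal.{u}} (hκ : κ.IsInaccessible) {C : Type v} [Category.{w} C]
    (γ : IRPlus κ C) : Fam κ C ⥤ Fam κ C where
  obj X := γ.skel.interp hκ X
  map φ := γ.pre.interp hκ φ
  map_id X := PreCode.interp_id hκ γ.wf X
  map_comp φ ψ := PreCode.interp_comp hκ γ.wf φ ψ

/-!
The initial chain `0 ⟶ ⟦γ⟧ 0 ⟶ ⟦γ⟧² 0 ⟶ ⋯` consists of morphisms `(h, k)` all of whose components
`k x` are identities, because a functor `F` under a `δ` sends identities to identities.  So the
decoding of an element never changes once the element has appeared, and the union of the chain over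
all ordinals is an inductively defined family `El s₀ s c`: the elements over the object `c` of the
interpretation of the code `s`, where `s₀` is the code under consideration.  This family lives in a
large universe.

Smallness is where the Mahlo property enters.  Elements have a rank, the stage at which they
appear.  Each stage before `κ` is small since `κ` is inaccessible (`hasCardinalLT_below`), and the
arities `A` of the `δ_A` met in evaluating the code along that stage are bounded below `κ`
(`exists_aritiesLT`).  The ordinals closed under passing from a stage to this bound form a closed
unbounded set (`isClub_aritiesLT`), which contains a regular cardinal `μ < κ`.  A function from a
set of cardinality less than `μ` into the elements of rank less than `μ` is bounded, so the chain
stops at `μ` (`rank_lt`), and there are fewer than `κ` elements (`hasCardinalLT_el`).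

Initiality is shown by recursion on elements.  Given an algebra `ψ : ⟦s₀⟧ Y ⟶ Y`, an element over `c`
is sent to an element of `⟦s⟧ Y` together with a morphism from `c` to its decoding (`El.elim`).
At `δ_A F` the morphisms `T a ⟶ Y` already obtained are turned into a morphism of codes by the
action of `F` on morphisms.  That this gives an algebra morphism, and the only one, both follow from
`El.elim_intro`, which rests on the naturality of the transformations induced by morphisms of codes.
-/

namespace PosIR

variable {κ : Cardinal.{u}} {C : Type v}

/-! ### Elements of the initial algebra -/

/-- `El s₀ s c` is the set of elements with decoding `c` of `⟦s⟧ U`, where `U` is the initial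
algebra of `⟦s₀⟧`.  This replaces the inductive-recursive definition of the index set of `U`
together with its decoding into `C` by an indexed inductive one, in a large universe: an element of
`U` over `c` is an element of `El s₀ s₀ c`.  In the constructor for `δ_A F`, the function `A → U` is
given by the objects `T` that it decodes to and by elements `g a` over `T a`. -/
inductive El (s₀ : Skel κ C) : Skel κ C → C → Type (max (u + 1) v)
  | iota (c : C) : El s₀ (.iota c) c
  | sigma {A : SmallSet κ} {f : A → Skel κ C} {c : C} (a : A) (x : El s₀ (f a) c) :
      El s₀ (.sigma A f) c
  | delta {A : SmallSet κ} {F : (A → C) → Skel κ C} {c : C} (T : A → C)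
      (g : ∀ a, El s₀ s₀ (T a)) (x : El s₀ (F T) c) : El s₀ (.delta A F) c

namespace El

variable {s₀ : Skel κ C}

/-- The stage of the initial chain needed to build an element: an element of `δ_A F` lies in
`⟦δ_A F⟧` of a stage if this stage contains all `g a`. -/
noncomputable def rank : {s : Skel κ C} → {c : C} → El s₀ s c → Ordinal.{u}
  | _, _, .iota _ => 0
  | _, _, .sigma _ x => x.rank
  | _, _, .delta _ g x => max (⨆ a, Order.succ (g a).rank) x.rank

theorem rank_delta_le {A : SmallSet κ} {F : (A → C) → Skel κ C} {c : C} {T : A → C}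
    {g : ∀ a, El s₀ s₀ (T a)} {x : El s₀ (F T) c} {α : Ordinal.{u}} :
    (El.delta (F := F) T g x).rank ≤ α ↔ (∀ a, (g a).rank < α) ∧ x.rank ≤ α := by
  rw [rank, max_le_iff, Ordinal.iSup_le_iff]
  simp only [Order.succ_le_iff]

end El

/-! ### Morphisms of families and their points -/

section
variable [Category.{w} C] (hκ : κ.IsInaccessible)

namespace Fam

/-- The one-member family `∗ ↦ c`. -/
def single (c : C) : Fam κ C := ⟨SmallSet.one hκ, fun _ => c⟩

/-- The member of `X` at `x`, as a morphism from a one-member family. -/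
def pt (X : Fam κ C) (x : X.idx) : single hκ (X.obj x) ⟶ X where
  fn _ := x
  app _ := 𝟙 (X.obj x)

/-- A morphism of families is a family of morphisms from one-member families. -/
def glue {X Y : Fam κ C} (r : ∀ x, single hκ (X.obj x) ⟶ Y) : X ⟶ Y where
  fn x := (r x).fn PUnit.unit
  app x := (r x).app PUnit.unit

theorem pt_glue {X Y : Fam κ C} (r : ∀ x, single hκ (X.obj x) ⟶ Y) (x : X.idx) :
    pt hκ X x ≫ glue hκ r = r x :=
  hom_congr (X := single hκ (X.obj x)) (r x).fn fun _ => Category.id_comp _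

theorem pt_ext {X Y : Fam κ C} {φ ψ : X ⟶ Y} (h : ∀ x, pt hκ X x ≫ φ = pt hκ X x ≫ ψ) :
    φ = ψ := by
  have key : ∀ χ : X ⟶ Y, χ = glue hκ fun x => pt hκ X x ≫ χ := fun χ =>
    hom_congr χ.fn fun _ => (Category.id_comp _).symm
  rw [key φ, key ψ, funext h]

theorem pt_desc {A : SmallSet κ} {Y : A → Fam κ C} {Z : Fam κ C} (φ : ∀ a, Y a ⟶ Z) (a : A)
    (y : (Y a).idx) :
    pt hκ (coprod hκ A Y) (⟨a, y⟩ : Σ a : A, (Y a).idx) ≫ desc hκ φ = pt hκ (Y a) y ≫ φ a :=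
  rfl

end Fam

open Fam

/-! ### Elimination of elements into algebras -/

variable {s₀ : Skel κ C}

/-- One step of the recursion, at `δ_A F`: given `q a : T a ⟶ Y` for all `a : A`, an element of
`⟦F T⟧ Y` is moved along the action `m` of `F` on the components of `q`, and becomes an element of
`⟦δ_A F⟧ Y` in the summand given by the indices of `q`. -/
def deltaStep {A : SmallSet κ} {F : (A → C) → Skel κ C}
    (m : ∀ X Y : A → C, (X ⟶ Y) → RawHom (F X) (F Y)) {Y : Fam κ C} {T : A → C}
    (q : ∀ a, single hκ (T a) ⟶ Y) {c : C} (r : single hκ c ⟶ (F T).interp hκ Y) :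
    single hκ c ⟶ (Skel.delta A F).interp hκ Y :=
  r ≫ (m T _ fun a => (q a).app PUnit.unit).interp hκ Y ≫
    Fam.inj (A := SmallSet.pi hκ A Y.idx) hκ
      (fun g : A → Y.idx => (F fun a => Y.obj (g a)).interp hκ Y) fun a => (q a).fn PUnit.unit

/-- Elimination into an algebra `ψ : ⟦s₀⟧ Y ⟶ Y`: each element of `⟦s⟧ U` over `c` yields an
element of `⟦s⟧ Y` together with a morphism from `c` to its decoding. -/
def El.elim (d₀ : PreCode s₀) {Y : Fam κ C} (ψ : s₀.interp hκ Y ⟶ Y) :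
    {s : Skel κ C} → {c : C} → El s₀ s c → PreCode s → (single hκ c ⟶ s.interp hκ Y)
  | _, _, .iota c, _ => 𝟙 (single hκ c)
  | _, _, .sigma (f := f) a x, .sigma d =>
      x.elim d₀ ψ (d a) ≫ Fam.inj hκ (fun a => (f a).interp hκ Y) a
  | _, _, .delta T g x, .delta d m =>
      deltaStep hκ m (fun a => (g a).elim d₀ ψ d₀ ≫ ψ) (x.elim d₀ ψ (d T))

/-! ### The initial algebra -/

/-- The family of all elements, indexed by a small set `K` in bijection with them. -/
abbrev elFam (K : SmallSet κ) (E : K ≃ Σ c, El s₀ s₀ c) : Fam κ C := ⟨K, fun u => (E u).1⟩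

variable (K : SmallSet κ) (E : K ≃ Σ c, El s₀ s₀ c)

/-- An element of the interpretation of `s` at the family of all elements is an element of `s`,
with the same decoding on the nose. -/
def El.intro : (s : Skel κ C) → (y : (s.interp hκ (elFam K E)).idx) →
    El s₀ s ((s.interp hκ (elFam K E)).obj y)
  | .iota c, _ => .iota c
  | .sigma _ f, ⟨a, y⟩ => .sigma a (El.intro (f a) y)
  | .delta _ F, ⟨g, y⟩ => .delta (F := F) _ (fun a => (E (g a)).2) (El.intro (F _) y)

/-- Surjectivity of `El.intro`.  The equation is one of dependent pairs, since the decoding of the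
element found equals `c` only propositionally. -/
theorem El.exists_intro {s : Skel κ C} {c : C} (x : El s₀ s c) :
    ∃ y, (⟨_, El.intro hκ K E s y⟩ : Σ c, El s₀ s c) = ⟨c, x⟩ := by
  induction x with
  | iota c => exact ⟨PUnit.unit, rfl⟩
  | @sigma A f c a x ih =>
    obtain ⟨y, hy⟩ := ih
    exact ⟨⟨a, y⟩, congrArg (fun p : Σ c, El s₀ (f a) c =>
      (⟨p.1, .sigma a p.2⟩ : Σ c, El s₀ (.sigma A f) c)) hy⟩
  | @delta A F c T g x _ ih =>
    -- The pair `(T, g)` is a function into the dependent sum, hence comes from a function into `K`.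
    have key : ∀ (G : A → Σ c, El s₀ s₀ c) (x : El s₀ (F fun a => (G a).1) c),
        (∃ y, (⟨_, El.intro hκ K E _ y⟩ : Σ c, El s₀ (F fun a => (G a).1) c) = ⟨c, x⟩) →
        ∃ y, (⟨_, El.intro hκ K E (.delta A F) y⟩ : Σ c, El s₀ (.delta A F) c) =
          ⟨c, .delta _ (fun a => (G a).2) x⟩ := by
      intro G x
      obtain ⟨g, rfl⟩ : ∃ g : A → K, (fun a => E (g a)) = G :=
        ⟨fun a => E.symm (G a), funext fun a => E.apply_symm_apply _⟩
      rintro ⟨y, hy⟩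
      exact ⟨⟨g, y⟩, congrArg (fun p : Σ c, El s₀ (F fun a => (E (g a)).1) c =>
        (⟨p.1, .delta _ (fun a => (E (g a)).2) p.2⟩ : Σ c, El s₀ (.delta A F) c)) hy⟩
    exact key (fun a => ⟨T a, g a⟩) x ih

/-- A morphism `φ` into the algebra `ψ` that agrees with the elimination on all elements of rank
less than `α` does so, after application of the interpretation `d` of a code, on all elements of
rank at most `α`.  At `δ`, the recursion acts on morphisms of codes last and `d.interp φ` does so
first; the two agree by naturality. -/
theorem El.elim_intro (d₀ : PreCode s₀) {Y : Fam κ C} (ψ : s₀.interp hκ Y ⟶ Y)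
    (φ : elFam K E ⟶ Y) {α : Ordinal.{u}}
    (hφ : ∀ u, (E u).2.rank < α → pt hκ (elFam K E) u ≫ φ = (E u).2.elim hκ d₀ ψ d₀ ≫ ψ)
    {s : Skel κ C} (d : PreCode s) (hd : d.WF) (y : (s.interp hκ (elFam K E)).idx)
    (hy : (El.intro hκ K E s y).rank ≤ α) :
    (El.intro hκ K E s y).elim hκ d₀ ψ d = pt hκ _ y ≫ d.interp hκ φ := by
  induction d with
  | iota c => exact Fam.hom_congr (X := single hκ c) _ fun _ => (Category.id_comp _).symm
  | @sigma A f d ih =>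
    obtain ⟨a, y⟩ := y
    refine Eq.trans ?_ (pt_desc hκ (fun a => (d a).interp hκ φ ≫
      Fam.inj hκ (fun a => (f a).interp hκ Y) a) a y).symm
    exact (congrArg (· ≫ _) (ih a (hd a) y hy)).trans (Category.assoc _ _ _)
  | @delta A F d m ih =>
    obtain ⟨g, y⟩ := y
    obtain ⟨hg, hy⟩ := El.rank_delta_le.1 hy
    refine Eq.trans ?_ (pt_desc (A := SmallSet.pi hκ A K) hκ (fun g : A → K =>
      (m _ _ fun a => φ.app (g a)).interp hκ (elFam K E) ≫
        (d fun a => Y.obj (φ.fn (g a))).interp hκ φ ≫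
          Fam.inj (A := SmallSet.pi hκ A Y.idx) hκ
            (fun g' : A → Y.idx => (F fun a => Y.obj (g' a)).interp hκ Y)
              fun a => φ.fn (g a)) g y).symm
    have hq : (fun a => (E (g a)).2.elim hκ d₀ ψ d₀ ≫ ψ) =
        fun a => pt hκ (elFam K E) (g a) ≫ φ := funext fun a => (hφ _ (hg a)).symm
    have hk : (fun a => (pt hκ (elFam K E) (g a) ≫ φ).app PUnit.unit) =
        fun a => φ.app (g a) := funext fun a => Category.id_comp _
    change deltaStep hκ m (fun a => (E (g a)).2.elim hκ d₀ ψ d₀ ≫ ψ)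
      ((El.intro hκ K E _ y).elim hκ d₀ ψ (d _)) = _
    rw [hq, ih _ (hd.1 _) y hy]
    refine (Category.assoc _ _ _).trans (congrArg (_ ≫ ·) ?_)
    refine (Category.assoc _ _ _).symm.trans (Eq.trans ?_ (Category.assoc _ _ _))
    refine congrArg (· ≫ _) ?_
    refine (congrArg (fun k => _ ≫ (m _ _ k).interp hκ Y) hk).trans ?_
    exact RawHom.interp_naturality hκ (hd.2.1 _ _ _) φ

/-- The point of the carrier given by an element.  The object at `E.symm p` equals `p.1` only
propositionally, whence the transport. -/
def ptOf (p : Σ c, El s₀ s₀ c) : single hκ p.1 ⟶ elFam K E :=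
  eqToHom (congrArg (fun q : Σ c, El s₀ s₀ c => single hκ q.1) (E.apply_symm_apply p).symm) ≫
    pt hκ (elFam K E) (E.symm p)

theorem ptOf_apply (u : K) : ptOf hκ K E (E u) = pt hκ (elFam K E) u := by
  have key : ∀ (v : K) (h : single hκ (E u).1 = single hκ (E v).1), v = u →
      eqToHom h ≫ pt hκ (elFam K E) v = pt hκ (elFam K E) u := by
    rintro v h rfl
    exact Category.id_comp _
  exact key _ _ (E.symm_apply_apply u)

/-- The algebra structure on the family of all elements. -/
def str : s₀.interp hκ (elFam K E) ⟶ elFam K E :=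
  glue hκ fun y => ptOf hκ K E ⟨_, El.intro hκ K E s₀ y⟩

/-- The morphism from the initial algebra to the algebra `ψ`. -/
def fold (d₀ : PreCode s₀) {Y : Fam κ C} (ψ : s₀.interp hκ Y ⟶ Y) : elFam K E ⟶ Y :=
  glue hκ fun u => (E u).2.elim hκ d₀ ψ d₀ ≫ ψ

theorem pt_fold (d₀ : PreCode s₀) {Y : Fam κ C} (ψ : s₀.interp hκ Y ⟶ Y) (u : K) :
    pt hκ (elFam K E) u ≫ fold hκ K E d₀ ψ = (E u).2.elim hκ d₀ ψ d₀ ≫ ψ :=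
  pt_glue hκ (X := elFam K E) (fun u => (E u).2.elim hκ d₀ ψ d₀ ≫ ψ) u

theorem str_fold {d₀ : PreCode s₀} (hd₀ : d₀.WF) {Y : Fam κ C} (ψ : s₀.interp hκ Y ⟶ Y) :
    d₀.interp hκ (fold hκ K E d₀ ψ) ≫ ψ = str hκ K E ≫ fold hκ K E d₀ ψ := by
  have hfold : ∀ p, ptOf hκ K E p ≫ fold hκ K E d₀ ψ = p.2.elim hκ d₀ ψ d₀ ≫ ψ := by
    intro p
    obtain ⟨u, rfl⟩ := E.surjective p
    rw [ptOf_apply, pt_fold]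
  refine pt_ext hκ fun y => ?_
  rw [← Category.assoc, ← Category.assoc, str, pt_glue, hfold]
  rw [El.elim_intro hκ K E d₀ ψ (fold hκ K E d₀ ψ) (fun u _ => pt_fold hκ K E d₀ ψ u)
    d₀ hd₀ y le_rfl]

/-- Uniqueness of `fold`, by induction on the rank. -/
theorem eq_fold {d₀ : PreCode s₀} (hd₀ : d₀.WF) {Y : Fam κ C} (ψ : s₀.interp hκ Y ⟶ Y)
    (φ : elFam K E ⟶ Y) (hφ : d₀.interp hκ φ ≫ ψ = str hκ K E ≫ φ) :
    φ = fold hκ K E d₀ ψ := by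
  have key : ∀ (α : Ordinal.{u}) (p : Σ c, El s₀ s₀ c), p.2.rank = α →
      ptOf hκ K E p ≫ φ = p.2.elim hκ d₀ ψ d₀ ≫ ψ := by
    intro α
    induction α using WellFoundedLT.induction with | ind α ih => ?_
    rintro ⟨c, x⟩ hp
    obtain ⟨y, hy⟩ := El.exists_intro hκ K E x
    rw [← hy] at hp ⊢
    rw [El.elim_intro hκ K E d₀ ψ φ (fun u hu => ?_) d₀ hd₀ y hp.le, Category.assoc, hφ,
      ← Category.assoc, str, pt_glue]
    rw [← ptOf_apply]
    exact ih _ hu _ rfl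
  refine pt_ext hκ fun (u : K) => ?_
  rw [pt_fold, ← key _ _ rfl, ptOf_apply]

end

end PosIR

open PosIR

/-- Once the elements form a small set, they are an initial algebra. -/
theorem IRPlus.hasInitial_algebra {κ : Cardinal.{u}} (hκ : κ.IsInaccessible) {C : Type v}
    [Category.{w} C] (γ : IRPlus κ C) (K : SmallSet κ) (E : K ≃ Σ c, El γ.skel γ.skel c) :
    Limits.HasInitial (Endofunctor.Algebra (γ.interp hκ)) := by
  let U : Endofunctor.Algebra (γ.interp hκ) := ⟨elFam K E, str hκ K E⟩
  refine Limits.IsInitial.hasInitial (X := U) (Limits.IsInitial.ofUniqueHom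
    (fun Y => ⟨fold hκ K E γ.pre Y.str, str_fold hκ K E γ.wf Y.str⟩) fun Y φ => ?_)
  exact Endofunctor.Algebra.Hom.ext (eq_fold hκ K E γ.wf Y.str φ.f φ.h)

namespace PosIR

variable {κ : Cardinal.{u}} {C : Type v}

/-! ### Smallness of the initial algebra -/

theorem SmallSet.exists_equiv {X : Type w} (hX : HasCardinalLT X κ) :
    ∃ K : SmallSet κ, Nonempty (K ≃ X) := by
  have := hX.small
  have h := (hasCardinalLT_iff_of_equiv (equivShrink.{u} X) κ).1 hX
  exact ⟨⟨Shrink X, (hasCardinalLT_iff_cardinal_mk_lt _ _).1 h⟩, ⟨(equivShrink X).symm⟩⟩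

theorem SmallSet.hasCardinalLT (A : SmallSet κ) : HasCardinalLT A κ :=
  (hasCardinalLT_iff_cardinal_mk_lt _ _).2 A.card_lt

theorem SmallSet.hasCardinalLT_fun (hκ : κ.IsInaccessible) (A : SmallSet κ) {X : Type w}
    (hX : HasCardinalLT X κ) : HasCardinalLT (A → X) κ := by
  obtain ⟨K, ⟨e⟩⟩ := SmallSet.exists_equiv hX
  exact (SmallSet.pi hκ A K).hasCardinalLT.of_surjective (fun (g : A → K) a => e (g a))
    fun g => ⟨fun a => e.symm (g a), funext fun a => e.apply_symm_apply _⟩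

/-- The elements of the initial algebra of rank less than `α`, i.e. the index set of the `α`-th
stage of the initial chain. -/
def Below (s₀ : Skel κ C) (α : Ordinal.{u}) : Type (max (u + 1) v) :=
  {p : Σ c, El s₀ s₀ c // p.2.rank < α}

/-- Applying the interpretation of a code `s` to a small stage of the initial chain gives a small
set: the elements of `s` of rank at most `α` are those built from the elements in `Below s₀ α`. -/
theorem hasCardinalLT_rank_le (hκ : κ.IsInaccessible) {s₀ : Skel κ C} {α : Ordinal.{u}}
    (hα : HasCardinalLT (Below s₀ α) κ) (s : Skel κ C) :
    HasCardinalLT {p : Σ c, El s₀ s c // p.2.rank ≤ α} κ := by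
  have : Fact κ.IsRegular := ⟨hκ.isRegular⟩
  induction s with
  | iota c =>
    refine (SmallSet.one hκ).hasCardinalLT.of_surjective
      (fun _ => ⟨⟨c, .iota c⟩, zero_le⟩) ?_
    rintro ⟨⟨_, ⟨⟩⟩, _⟩
    exact ⟨PUnit.unit, rfl⟩
  | sigma A f ih =>
    refine (hasCardinalLT_sigma _ κ A.hasCardinalLT ih).of_surjective
      (fun p => ⟨⟨p.2.1.1, .sigma p.1 p.2.1.2⟩, p.2.2⟩) ?_
    rintro ⟨⟨c, _ | ⟨a, x⟩⟩, h⟩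
    exact ⟨⟨a, ⟨c, x⟩, h⟩, rfl⟩
  | delta A F ih =>
    refine (hasCardinalLT_sigma _ κ (A.hasCardinalLT_fun hκ hα)
      fun g => ih fun a => (g a).1.1).of_surjective
      (fun p => ⟨⟨p.2.1.1, .delta _ (fun a => (p.1 a).1.2) p.2.1.2⟩,
        El.rank_delta_le.2 ⟨fun a => (p.1 a).2, p.2.2⟩⟩) ?_
    rintro ⟨⟨c, _ | _ | ⟨T, g, x⟩⟩, h⟩
    have h' := El.rank_delta_le.1 h
    exact ⟨⟨fun a => ⟨⟨T a, g a⟩, h'.1 a⟩, ⟨c, x⟩, h'.2⟩, rfl⟩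

theorem hasCardinalLT_below (hκ : κ.IsInaccessible) (s₀ : Skel κ C) (α : Ordinal.{u})
    (hα : α < κ.ord) : HasCardinalLT (Below s₀ α) κ := by
  have : Fact κ.IsRegular := ⟨hκ.isRegular⟩
  induction α using WellFoundedLT.induction with | ind α ih => ?_
  have hI : HasCardinalLT (Set.Iio α) κ := by
    rw [HasCardinalLT, Cardinal.mk_Iio_ordinal, Cardinal.lift_lift]
    exact Cardinal.lift_lt.2 (Cardinal.lt_ord.1 hα)
  refine (hasCardinalLT_sigma _ κ hI fun β : Set.Iio α =>
    hasCardinalLT_rank_le hκ (ih β.1 β.2 (β.2.trans hα)) s₀).of_surjective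
    (fun p => ⟨p.2.1, p.2.2.trans_lt p.1.2⟩) ?_
  rintro ⟨p, hp⟩
  exact ⟨⟨⟨_, hp⟩, p, le_rfl⟩, rfl⟩

/-- Every set `A` at which a `δ_A` is met when `s` is evaluated along the stage `Below s₀ α`, has
cardinality with initial ordinal less than `ν`.  Which codes are met under a `δ_A F` depends on the
stage, since `F` is applied to the families of objects occurring there. -/
def AritiesLT (s₀ : Skel κ C) (α ν : Ordinal.{u}) : Skel κ C → Prop
  | .iota _ => True
  | .sigma _ f => ∀ a, AritiesLT s₀ α ν (f a)
  | .delta A F => (Cardinal.mk A).ord < ν ∧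
      ∀ g : A → Below s₀ α, AritiesLT s₀ α ν (F fun a => (g a).1.1)

theorem AritiesLT.mono {s₀ s : Skel κ C} {α ν ν' : Ordinal.{u}} (h : ν ≤ ν')
    (hs : AritiesLT s₀ α ν s) : AritiesLT s₀ α ν' s := by
  induction s with
  | iota c => trivial
  | sigma A f ih => exact fun a => ih a (hs a)
  | delta A F ih => exact ⟨hs.1.trans_le h, fun g => ih _ (hs.2 g)⟩

/-- The arities met along one stage below `κ` are bounded below `κ`, as there are fewer than `κ`
of them and `κ` is regular. -/
theorem exists_aritiesLT (hκ : κ.IsInaccessible) {s₀ : Skel κ C} {α : Ordinal.{u}}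
    (hα : α < κ.ord) (s : Skel κ C) : ∃ ν < κ.ord, AritiesLT s₀ α ν s := by
  induction s with
  | iota c => exact ⟨0, hκ.isRegular.ord_pos, trivial⟩
  | sigma A f ih =>
    choose ν hν hs using ih
    exact ⟨⨆ a, ν a, Ordinal.iSup_lt_of_lt_cof (A.card_lt.trans_eq hκ.isRegular.cof_ord.symm) hν,
      fun a => (hs a).mono (Ordinal.le_iSup ν a)⟩
  | delta A F ih =>
    choose ν hν hs using ih
    obtain ⟨K, ⟨e⟩⟩ := SmallSet.exists_equiv (hasCardinalLT_below hκ s₀ α hα)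
    let ν' : (A → K) → Ordinal.{u} := fun g => ν fun a => (e (g a)).1.1
    refine ⟨max (Order.succ (Cardinal.mk A).ord) (⨆ g, ν' g), max_lt ?_ ?_, ?_, fun g => ?_⟩
    · exact (Cardinal.isSuccLimit_ord hκ.isRegular.aleph0_le).succ_lt
        (Cardinal.ord_lt_ord.2 A.card_lt)
    · exact Ordinal.iSup_lt_of_lt_cof
        ((SmallSet.card_fun_lt hκ A K).trans_eq hκ.isRegular.cof_ord.symm) fun g => hν _
    · exact lt_max_of_lt_left (Order.lt_succ _)
    · obtain ⟨g, rfl⟩ : ∃ g' : A → K, (fun a => e (g' a)) = g :=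
        ⟨fun a => e.symm (g a), funext fun a => e.apply_symm_apply _⟩
      exact (hs _).mono ((Ordinal.le_iSup ν' g).trans (le_max_right _ _))

/-- The ordinals `μ` that bound all arities met along the stages before `μ` form a closed unbounded
set. -/
theorem isClub_aritiesLT (hκ : κ.IsInaccessible) (s₀ : Skel κ C) :
    IsClub {μ | μ < κ.ord ∧ ∀ α < μ, AritiesLT s₀ α μ s₀} κ.ord where
  subset _ h := h.1
  closed p hp _ h := ⟨hp, fun α hα => by
    obtain ⟨b, hb, hαb, hbp⟩ := h α hα
    exact (hb.2 α hαb).mono hbp.le⟩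
  unbounded a ha := by
    -- Closing `a` under a bound `ν` for the arities takes `ω` steps, and `κ` is uncountable.
    have hlim := Cardinal.isSuccLimit_ord hκ.isRegular.aleph0_le
    choose! ν hν hs using fun α (hα : α < κ.ord) => exists_aritiesLT hκ (s₀ := s₀) hα s₀
    let f : Ordinal.{u} → Ordinal.{u} := fun b =>
      max (Order.succ b) (⨆ α : Set.Iio b, ν α.1)
    have hf : ∀ b < κ.ord, f b < κ.ord := fun b hb => by
      refine max_lt (hlim.succ_lt hb) ?_
      refine Ordinal.lift_iSup_lt_of_lt_cof ?_ fun α => hν α.1 (α.2.trans hb)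
      rw [Cardinal.mk_Iio_ordinal, ← Ordinal.lift_cof, hκ.isRegular.cof_ord, Cardinal.lift_lift]
      exact Cardinal.lift_lt.2 (Cardinal.lt_ord.1 hb)
    have hmem : ∀ n, f^[n] a < κ.ord := fun n => by
      induction n with
      | zero => exact ha
      | succ n ih => rw [Function.iterate_succ_apply']; exact hf _ ih
    refine ⟨Ordinal.nfp f a, ⟨?_, fun α hα => ?_⟩, ?_⟩
    · exact Cardinal.nfp_lt_ord_of_isRegular hκ.isRegular hκ.aleph0_lt.ne' hf ha
    · obtain ⟨n, hn⟩ := Ordinal.lt_nfp_iff.1 hα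
      refine (hs α (hn.trans (hmem n))).mono ?_
      refine le_trans ?_ (Ordinal.iterate_le_nfp f a (n + 1))
      rw [Function.iterate_succ_apply']
      exact (Ordinal.le_iSup (fun α : Set.Iio (f^[n] a) => ν α.1) ⟨α, hn⟩).trans
        (le_max_right _ _)
    · exact Ordinal.lt_nfp_iff.2 ⟨1, (Order.lt_succ a).trans_le (le_max_left _ _)⟩

/-- If `μ` is regular and exceeds all arities met along the stages before `μ`, then the initial
chain stops at `μ`: an element built at `μ` uses fewer than `μ` previous elements, whose ranks are
therefore bounded below `μ`.  For the induction, the arities of a general code `s` need only be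
bounded along the stages from some `β < μ` on. -/
theorem rank_lt (s₀ : Skel κ C) {μ : Cardinal.{u}} (hμ : μ.IsRegular)
    (h₀ : ∀ α < μ.ord, AritiesLT s₀ α μ.ord s₀) {s : Skel κ C} {c : C} (x : El s₀ s c)
    (hs : ∃ β < μ.ord, ∀ α, β ≤ α → α < μ.ord → AritiesLT s₀ α μ.ord s) : x.rank < μ.ord := by
  induction x with
  | iota c => exact hμ.ord_pos
  | sigma a x ih =>
    obtain ⟨β, hβ, hs⟩ := hs
    exact ih ⟨β, hβ, fun α h h' => hs α h h' a⟩
  | @delta A F c T g x ihg ih =>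
    obtain ⟨β, hβ, hs⟩ := hs
    have hg : ∀ a, Order.succ (g a).rank < μ.ord := fun a =>
      (Cardinal.isSuccLimit_ord hμ.aleph0_le).succ_lt
        (ihg a ⟨0, hμ.ord_pos, fun α _ h => h₀ α h⟩)
    have hA : Cardinal.mk A < μ := Cardinal.ord_lt_ord.1 (hs β le_rfl hβ).1
    have hsup := Ordinal.iSup_lt_of_lt_cof (hA.trans_eq hμ.cof_ord.symm) hg
    -- From this stage on, `g` takes values in the stage, so that the code `F T` is met there.
    refine max_lt hsup (ih ⟨max β (⨆ a, Order.succ (g a).rank), max_lt hβ hsup,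
      fun α h h' => ?_⟩)
    exact (hs α ((le_max_left _ _).trans h) h').2 fun a => ⟨⟨T a, g a⟩,
      (Order.lt_succ _).trans_le ((Ordinal.le_iSup (fun a => Order.succ (g a).rank) a).trans
        ((le_max_right _ _).trans h))⟩

/-- The index set of the initial algebra is small. -/
theorem hasCardinalLT_el (hκ : IsMahlo κ) (s₀ : Skel κ C) :
    HasCardinalLT (Σ c, El s₀ s₀ c) κ := by
  obtain ⟨μ, hμ, hμκ, h₀⟩ := hκ.stationary _ (isClub_aritiesLT hκ.isInaccessible s₀)
  exact (hasCardinalLT_below hκ.isInaccessible s₀ μ.ord hμκ).of_surjective Subtype.val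
    fun p => ⟨⟨p, rank_lt s₀ hμ h₀ p.2 ⟨0, hμ.ord_pos, fun α _ => h₀ α⟩⟩, rfl⟩

end PosIR

theorem mainTheorem2 (κ : Cardinal.{u}) (hκ : IsMahlo κ) (C : Type v) [Category.{w} C]
    (hC : ∀ (J : Type u) [SmallCategory J] [IsConnected J],
      HasCardinalLT (Arrow J) κ → Limits.HasColimitsOfShape J C)
    (γ : IRPlus κ C) :
    Limits.HasInitial (Endofunctor.Algebra (γ.interp hκ.isInaccessible)) := by
  obtain ⟨K, ⟨E⟩⟩ := SmallSet.exists_equiv (hasCardinalLT_el hκ γ.skel)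
  exact γ.hasInitial_algebra hκ.isInaccessible K E
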